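/- Let $\theta\in\mathbb R$ (for instance $0\le\theta<2\pi$), let $u\in\mathbb H$ be a real quaternion, and let $\psi=(\psi_0,\psi_1,\psi_2,\psi_3)=(1,\ i,\ ie^{i\theta}j,\ e^{i\theta}j)$. Points of $\mathbb R^4\cong\mathbb C^2$ are written $z=(x_0,x_1,x_2,x_3)$, with $z_1=x_0+x_1i$ and $z_2=x_2+x_3i$ (so $z$ is identified with the quaternion $\sum_k x_k\psi_k=z_1+ie^{i\theta}jz_2$). Writing $u=\sum_k u_k\psi_k$ with $u_k\in\mathbb R$, put $\langle u,z\rangle_\theta=\sum_{k=0}^3u_kx_k$. Define, for $w\in\mathbb R^4\setminus\{0\}$, $$K_\theta(w)=\frac{1}{2\pi^2|w|^4}\left[\overline{w_1}-ie^{i\theta}\,\overline{w_2}\,j\right],\qquad K^\theta_u(w)=e^{\langle u,w\rangle_\theta}K_\theta(w),$$ and the operator ${}^\theta_u\mathcal D[F]=\sum_{k=0}^3\psi_k\frac{\partial F}{\partial x_k}+uF$. Let $\Omega\subset\mathbb R^4$ be a bounded open set (in particular, a bounded domain) and let $f:\Omega\to\mathbb H$ belong to $L_2(\Omega,\mathbb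 H)$, or be continuous on $\Omega$ and integrable over $\Omega$ (the latter is automatic if $f\in C(\overline\Omega,\mathbb H)$). Define the Teodorescu-type operator $${}^\theta_uT[f](z)=-\int_\Omega K^\theta_u(\zeta-z)\,f(\zeta)\,d\mu_\zeta .$$ Then this integral converges absolutely for almost every $z\in\Omega$ (for every $z\in\Omega$ if $f$ is continuous on $\Omega$), and ${}^\theta_uT$ is a right inverse of ${}^\theta_u\mathcal D$: $${}^\theta_u\mathcal D\big[{}^\theta_uT[f]\big]=f\quad\text{on }\Omega,$$ where ${}^\theta_u\mathcal D$ is taken in the sense of distributions; that is, ${}^\theta_uT[f]$ and $f$ are locally integrable on $\Omega$ and $$\int_\Omega\Big(-\sum_{k=0}^3\frac{\partial\varphi}{\partial x_k}\,\psi_k\;{}^\theta_uT[f]+\varphi\,u\;{}^\theta_uT[f]\Big)d\mu=\int_\Omega\varphi f\,d\mu\qquad\text{for all }\varphi\in C_c^\infty(\Omega,\mathbb R).$$ In particular, whenever $F\in C^1(\Omega,\mathbb H)$ coincides with ${}^\theta_uT[f]$ almost everywhere on $\Omega$, the classical identity ${}^\theta_u\mathcal D[F]=f$ holds almost everywhere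 on $\Omega$, and at every point of $\Omega$ if $f$ is continuous on $\Omega$. -/

import Mathlib

open MeasureTheory Quaternion
open scoped ComplexConjugate ContDiff

namespace ThetaHyper

noncomputable section

/-- The real coordinate space `ℝ⁴ ≅ ℂ²` with its Euclidean norm and Lebesgue measure. -/
abbrev R4 : Type := EuclideanSpace ℝ (Fin 4)

/-- The quaternion unit `j`. -/
def qj : ℍ[ℝ] := ⟨0, 0, 1, 0⟩

/-- The structural set `(1, i, i e^{iθ} j, e^{iθ} j)`. -/
def psi (θ : ℝ) : Fin 4 → ℍ[ℝ] :=
  ![1,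
    ((Complex.I : ℂ) : ℍ[ℝ]),
    ((Complex.I * Complex.exp (θ * Complex.I) : ℂ) : ℍ[ℝ]) * qj,
    ((Complex.exp (θ * Complex.I) : ℂ) : ℍ[ℝ]) * qj]

/-- The first complex coordinate `z₁ = x₀ + x₁ i`. -/
def z1 (x : R4) : ℂ := x 0 + x 1 * Complex.I

/-- The second complex coordinate `z₂ = x₂ + x₃ i`. -/
def z2 (x : R4) : ℂ := x 2 + x 3 * Complex.I

/-- The `k`-th real coordinate of a quaternion `u` in the orthonormal basis `psi θ`. -/
def coord (θ : ℝ) (u : ℍ[ℝ]) (k : Fin 4) : ℝ := inner ℝ (psi θ k) u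

/-- The real bilinear form `⟨u, z⟩_θ = ∑ uₖ xₖ`, where `u = ∑ uₖ ψₖ` and `z = ∑ xₖ ψₖ`. -/
def pairing (θ : ℝ) (u : ℍ[ℝ]) (x : R4) : ℝ := ∑ k, coord θ u k * x k

/-- The `θ`-hyperholomorphic Cauchy kernel
`K_θ(w) = (w̄₁ - i e^{iθ} w̄₂ j) / (2 π² |w|⁴)`. -/
def cauchyKernel (θ : ℝ) (w : R4) : ℍ[ℝ] :=
  (1 / (2 * Real.pi ^ 2 * ‖w‖ ^ 4)) •
    (((conj (z1 w) : ℂ) : ℍ[ℝ]) -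
      ((Complex.I * Complex.exp (θ * Complex.I) * conj (z2 w) : ℂ) : ℍ[ℝ]) * qj)

/-- The kernel `K^θ_u(w) = e^{⟨u, w⟩_θ} K_θ(w)`. -/
def kernelU (θ : ℝ) (u : ℍ[ℝ]) (w : R4) : ℍ[ℝ] :=
  Real.exp (pairing θ u w) • cauchyKernel θ w

/-- The Teodorescu-type operator `T^θ_u[f](z) = - ∫_Ω K^θ_u(ζ - z) f(ζ) dμ_ζ`. -/
def teodorescu (θ : ℝ) (u : ℍ[ℝ]) (Ω : Set R4) (f : R4 → ℍ[ℝ]) (z : R4) : ℍ[ℝ] :=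
  -∫ ζ in Ω, kernelU θ u (ζ - z) * f ζ

/-- The partial derivative `∂F/∂xₖ`. -/
def partialD {V : Type*} [NormedAddCommGroup V] [NormedSpace ℝ V]
    (k : Fin 4) (F : R4 → V) (x : R4) : V :=
  fderiv ℝ F x (EuclideanSpace.single k 1)

/-- The classical left operator `D^θ_u[F] = ∑ ψₖ ∂F/∂xₖ + u F`, for `F` of class `C¹`. -/
def crOp (θ : ℝ) (u : ℍ[ℝ]) (F : R4 → ℍ[ℝ]) (x : R4) : ℍ[ℝ] :=
  (∑ k, psi θ k * partialD k F x) + u * F x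

/-- `D^θ_u[F] = g` on the open set `Ω` in the sense of distributions: `F` and `g` are locally
integrable on `Ω`, and the identity holds after integration against every real test function,
the derivatives being moved to the test function. -/
def WeakCR (θ : ℝ) (u : ℍ[ℝ]) (Ω : Set R4) (F g : R4 → ℍ[ℝ]) : Prop :=
  LocallyIntegrableOn F Ω ∧ LocallyIntegrableOn g Ω ∧
    ∀ φ : R4 → ℝ, ContDiff ℝ ∞ φ → HasCompactSupport φ → tsupport φ ⊆ Ω →
      ∫ x in Ω, (-(∑ k, partialD k φ x • (psi θ k * F x)) + φ x • (u * F x)) =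
        ∫ x in Ω, φ x • g x

end

end ThetaHyper

namespace ThetaHyper

open Filter Topology

/-! ### The structural set and the quaternion attached to a point -/

/-! Write `q(w) = ∑ wₖ ψₖ`. Since the `ψₖ` are orthonormal, `|q(w)| = |w|`, and the Cauchy kernel is
`K = conj q(w) / (2π²|w|⁴)`, of size `|w|⁻³`, hence locally integrable in dimension 4. The heart of
the matter is that `K` is a fundamental solution, `∑ ψₖ ∂ₖK = δ₀`
(`integral_partialD_smul_cauchyKernel`). To avoid excising a ball, `|w|²` is replaced by `|w|² + ε`:
then `∑ ψₖ ∂ₖK_ε` is an explicit real approximate identity, and `ε → 0` is taken by dominated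
convergence.

The exponential absorbs the zero-order term: `-K_u(-w) = e^{-⟨u,w⟩} K(w)`, and `∑ ψₖ ∂ₖ e^{-⟨u,w⟩} =
-u e^{-⟨u,w⟩}` cancels `+u`. Moving the weight into the test function gives
`integral_adjointSymbol_mul_kernelU`. Fubini then yields the weak identity for every integrable `f`,
the factor `f(ζ)` staying on the right throughout. For a `C¹` representative, integration by parts
and the fundamental lemma of the calculus of variations give the classical identity. -/

@[simp] lemma qj_re : qj.re = 0 := rfl

@[simp] lemma qj_imI : qj.imI = 0 := rfl

@[simp] lemma qj_imJ : qj.imJ = 1 := rfl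

@[simp] lemma qj_imK : qj.imK = 0 := rfl

lemma psi_re (θ : ℝ) (k : Fin 4) : (psi θ k).re = ![1, 0, 0, 0] k := by
  fin_cases k <;> simp [psi]

lemma psi_imI (θ : ℝ) (k : Fin 4) : (psi θ k).imI = ![0, 1, 0, 0] k := by
  fin_cases k <;> simp [psi]

lemma psi_imJ (θ : ℝ) (k : Fin 4) :
    (psi θ k).imJ = ![0, 0, -Real.sin θ, Real.cos θ] k := by
  fin_cases k <;> simp [psi, Complex.exp_re, Complex.exp_im]

lemma psi_imK (θ : ℝ) (k : Fin 4) :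
    (psi θ k).imK = ![0, 0, Real.cos θ, Real.sin θ] k := by
  fin_cases k <;> simp [psi, Complex.exp_re, Complex.exp_im]

/-- The quaternion `∑ xₖ ψₖ` attached to a point `x`. -/
noncomputable def toQuat (θ : ℝ) : R4 →ₗ[ℝ] ℍ[ℝ] where
  toFun x := ∑ k, x k • psi θ k
  map_add' x y := by simp [add_smul, Finset.sum_add_distrib]
  map_smul' r x := by simp [mul_smul, Finset.smul_sum]

lemma toQuat_apply (θ : ℝ) (x : R4) : toQuat θ x = ∑ k, x k • psi θ k := rfl

lemma toQuat_re (θ : ℝ) (x : R4) : (toQuat θ x).re = x 0 := by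
  simp [toQuat_apply, Fin.sum_univ_four, psi_re]

lemma toQuat_imI (θ : ℝ) (x : R4) : (toQuat θ x).imI = x 1 := by
  simp [toQuat_apply, Fin.sum_univ_four, psi_imI]

lemma toQuat_imJ (θ : ℝ) (x : R4) :
    (toQuat θ x).imJ = -(x 2 * Real.sin θ) + x 3 * Real.cos θ := by
  simp [toQuat_apply, Fin.sum_univ_four, psi_imJ]

lemma toQuat_imK (θ : ℝ) (x : R4) :
    (toQuat θ x).imK = x 2 * Real.cos θ + x 3 * Real.sin θ := by
  simp [toQuat_apply, Fin.sum_univ_four, psi_imK]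

lemma toQuat_single (θ : ℝ) (k : Fin 4) : toQuat θ (EuclideanSpace.single k 1) = psi θ k := by
  simp [toQuat_apply, ite_smul]

/-- `ψ₂` and `ψ₃` are `k` and `j` turned through `θ` in the `jk`-plane (up to orientation), so `θ`
drops out. -/
lemma normSq_toQuat (θ : ℝ) (x : R4) : normSq (toQuat θ x) = ‖x‖ ^ 2 := by
  rw [EuclideanSpace.real_norm_sq_eq, Fin.sum_univ_four, normSq_def', toQuat_re, toQuat_imI,
    toQuat_imJ, toQuat_imK]
  linear_combination (x 2 ^ 2 + x 3 ^ 2) * Real.sin_sq_add_cos_sq θ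

lemma norm_toQuat (θ : ℝ) (x : R4) : ‖toQuat θ x‖ = ‖x‖ := by
  have h := normSq_toQuat θ x
  rw [normSq_eq_norm_mul_self, ← sq] at h
  exact (sq_eq_sq₀ (norm_nonneg _) (norm_nonneg _)).1 h

lemma toQuat_mul_star (θ : ℝ) (x : R4) :
    toQuat θ x * star (toQuat θ x) = ((‖x‖ ^ 2 : ℝ) : ℍ[ℝ]) := by
  rw [self_mul_star, normSq_toQuat]

lemma psi_mul_star (θ : ℝ) (k : Fin 4) : psi θ k * star (psi θ k) = 1 := by
  rw [← toQuat_single, toQuat_mul_star]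
  simp

lemma sum_coord_smul_psi (θ : ℝ) (u : ℍ[ℝ]) : ∑ k, coord θ u k • psi θ k = u := by
  have h := Real.sin_sq_add_cos_sq θ
  ext
  · simp [coord, inner_def, Fin.sum_univ_four, psi_re, psi_imI, psi_imJ, psi_imK]
  · simp [coord, inner_def, Fin.sum_univ_four, psi_re, psi_imI, psi_imJ, psi_imK]
  · simp [coord, inner_def, Fin.sum_univ_four, psi_re, psi_imI, psi_imJ, psi_imK]
    linear_combination u.imJ * h
  · simp [coord, inner_def, Fin.sum_univ_four, psi_re, psi_imI, psi_imJ, psi_imK]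
    linear_combination u.imK * h

lemma continuous_toQuat (θ : ℝ) : Continuous (toQuat θ) :=
  (toQuat θ).continuous_of_finiteDimensional

lemma cauchyKernel_eq (θ : ℝ) (w : R4) :
    cauchyKernel θ w = (1 / (2 * Real.pi ^ 2 * ‖w‖ ^ 4)) • star (toQuat θ w) := by
  rw [cauchyKernel]
  congr 1
  ext <;> simp [z1, z2, toQuat_re, toQuat_imI, toQuat_imJ, toQuat_imK, Complex.exp_re,
    Complex.exp_im] <;> ring

lemma cauchyKernel_neg (θ : ℝ) (w : R4) : cauchyKernel θ (-w) = -cauchyKernel θ w := by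
  simp [cauchyKernel_eq]

lemma norm_cauchyKernel (θ : ℝ) (w : R4) :
    ‖cauchyKernel θ w‖ = (1 / (2 * Real.pi ^ 2)) * ‖w‖ ^ (-3 : ℝ) := by
  rw [cauchyKernel_eq, norm_smul, norm_star, norm_toQuat]
  -- At the origin both sides are 0: division by zero gives 0, and so does the real power `0 ^
  -- (-3)`.
  rcases eq_or_ne w 0 with rfl | hw
  · simp
  · have h : 0 < ‖w‖ := norm_pos_iff.2 hw
    rw [Real.rpow_neg h.le, show (3 : ℝ) = ((3 : ℕ) : ℝ) by norm_num, Real.rpow_natCast,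
      Real.norm_of_nonneg (by positivity)]
    field_simp

lemma stronglyMeasurable_cauchyKernel (θ : ℝ) : StronglyMeasurable (cauchyKernel θ) := by
  have h : cauchyKernel θ = fun w => (1 / (2 * Real.pi ^ 2 * ‖w‖ ^ 4)) • star (toQuat θ w) :=
    funext (cauchyKernel_eq θ)
  rw [h]
  have h1 : Measurable fun w : R4 => 1 / (2 * Real.pi ^ 2 * ‖w‖ ^ 4) := by fun_prop
  exact h1.stronglyMeasurable.smul (continuous_toQuat θ).star.stronglyMeasurable

/-! ### The Cauchy kernel is a fundamental solution -/

lemma locallyIntegrable_cauchyKernel (θ : ℝ) : LocallyIntegrable (cauchyKernel θ) := by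
  refine locallyIntegrable_of_norm_le_rpow (C := 1 / (2 * Real.pi ^ 2)) (α := 3) (by simp)
    (by simp; norm_num) ?_ ?_
  · filter_upwards with x
    exact (norm_cauchyKernel θ x).le
  · exact (stronglyMeasurable_cauchyKernel θ).aestronglyMeasurable

/-- The conjugate of `toQuat θ`, as a continuous linear map. -/
noncomputable def conjQuat (θ : ℝ) : R4 →L[ℝ] ℍ[ℝ] :=
  LinearMap.toContinuousLinearMap
    { toFun := fun x => star (toQuat θ x)
      map_add' := fun x y => by simp
      map_smul' := fun c x => by simp [Quaternion.star_smul] }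

lemma conjQuat_apply (θ : ℝ) (x : R4) : conjQuat θ x = star (toQuat θ x) := rfl

lemma coe_eq_smul_one (c : ℝ) : (c : ℍ[ℝ]) = c • 1 := by
  rw [← coe_one, smul_coe, mul_one]

/-- The Cauchy kernel with `‖w‖²` replaced by `‖w‖² + ε`, which is smooth for `ε > 0`. -/
noncomputable def regKernel (θ ε : ℝ) (w : R4) : ℍ[ℝ] :=
  (2 * Real.pi ^ 2 * (‖w‖ ^ 2 + ε) ^ 2)⁻¹ • star (toQuat θ w)

lemma regKernel_zero (θ : ℝ) : regKernel θ 0 = cauchyKernel θ := by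
  ext1 w
  rw [regKernel, cauchyKernel_eq, add_zero, ← pow_mul, one_div]

/-- Provides the dominating function for the limit `ε → 0`. -/
lemma norm_regKernel_le (θ : ℝ) {ε : ℝ} (hε : 0 ≤ ε) (w : R4) :
    ‖regKernel θ ε w‖ ≤ ‖cauchyKernel θ w‖ := by
  rcases eq_or_ne w 0 with rfl | hw
  · simp [regKernel]
  have h : 0 < ‖w‖ := norm_pos_iff.2 hw
  rw [← regKernel_zero, regKernel, regKernel, norm_smul, norm_smul]
  gcongr
  rw [Real.norm_of_nonneg (by positivity), Real.norm_of_nonneg (by positivity)]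
  gcongr

lemma tendsto_regKernel (θ : ℝ) (w : R4) :
    Tendsto (fun ε => regKernel θ ε w) (𝓝[>] 0) (𝓝 (cauchyKernel θ w)) := by
  rcases eq_or_ne w 0 with rfl | hw
  · simp [regKernel, cauchyKernel_eq]
  have h : 0 < ‖w‖ := norm_pos_iff.2 hw
  rw [← regKernel_zero]
  have hc : ContinuousAt (fun ε => regKernel θ ε w) 0 := by
    have hp : Continuous fun ε : ℝ => 2 * Real.pi ^ 2 * (‖w‖ ^ 2 + ε) ^ 2 := by fun_prop
    refine ContinuousAt.smul (hp.continuousAt.inv₀ ?_) continuousAt_const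
    positivity
  exact hc.tendsto.mono_left nhdsWithin_le_nhds

lemma hasFDerivAt_regKernel (θ : ℝ) {ε : ℝ} (hε : 0 < ε) (w : R4) :
    ∃ L : R4 →L[ℝ] ℍ[ℝ], HasFDerivAt (regKernel θ ε) L w ∧ ∀ v, L v =
      (2 * Real.pi ^ 2 * (‖w‖ ^ 2 + ε) ^ 2)⁻¹ • star (toQuat θ v) -
        (4 * inner ℝ w v / (2 * Real.pi ^ 2 * (‖w‖ ^ 2 + ε) ^ 3)) • star (toQuat θ w) := by
  have h1 : HasFDerivAt (fun x : R4 => ‖x‖ ^ 2) (2 • innerSL ℝ w) w :=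
    (hasStrictFDerivAt_norm_sq w).hasFDerivAt
  have hpos : 0 < ‖w‖ ^ 2 + ε := by positivity
  have h2 := ((h1.add_const ε).pow 2).const_mul (2 * Real.pi ^ 2)
  have h3 := (hasDerivAt_inv
    (by positivity : (2 * Real.pi ^ 2 * (‖w‖ ^ 2 + ε) ^ 2) ≠ 0)).comp_hasFDerivAt w h2
  have h4 : HasFDerivAt (fun x => star (toQuat θ x)) (conjQuat θ) w := (conjQuat θ).hasFDerivAt
  refine ⟨_, h3.smul h4, fun v => ?_⟩
  simp [conjQuat_apply, sub_eq_add_neg]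
  congr 1
  field_simp
  ring

lemma partialD_psi_mul_regKernel (θ : ℝ) {ε : ℝ} (hε : 0 < ε) (k : Fin 4) (w : R4) :
    partialD k (fun x => psi θ k * regKernel θ ε x) w =
      (2 * Real.pi ^ 2 * (‖w‖ ^ 2 + ε) ^ 2)⁻¹ • 1 -
        (4 / (2 * Real.pi ^ 2 * (‖w‖ ^ 2 + ε) ^ 3)) •
          ((w k • psi θ k) * star (toQuat θ w)) := by
  obtain ⟨L, hL, hv⟩ := hasFDerivAt_regKernel θ hε w
  have h := hL.const_mul (psi θ k)
  rw [partialD, h.fderiv]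
  simp only [smul_apply, hv, toQuat_single, smul_eq_mul, mul_sub,
    mul_smul_comm, psi_mul_star, smul_mul_assoc, smul_smul]
  congr 2
  simp [PiLp.inner_apply]
  ring

/-- The four terms `ψₖ conj ψₖ = 1` meet the 4 from differentiating the inverse square: with `s =
|w|²`, `4/(s+ε)² - 4s/(s+ε)³ = 4ε/(s+ε)³`. The exponent thus matches the dimension. -/
lemma sum_partialD_psi_mul_regKernel (θ : ℝ) {ε : ℝ} (hε : 0 < ε) (w : R4) :
    ∑ k, partialD k (fun x => psi θ k * regKernel θ ε x) w =
      ((4 * ε / (2 * Real.pi ^ 2 * (‖w‖ ^ 2 + ε) ^ 3) : ℝ) : ℍ[ℝ]) := by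
  simp only [partialD_psi_mul_regKernel θ hε, Finset.sum_sub_distrib, ← Finset.smul_sum,
    ← Finset.sum_mul, ← toQuat_apply, toQuat_mul_star]
  have hpos : 0 < ‖w‖ ^ 2 + ε := by positivity
  rw [coe_eq_smul_one, coe_eq_smul_one, Finset.sum_const, Finset.card_univ, Fintype.card_fin,
    ← Nat.cast_smul_eq_nsmul ℝ, smul_smul, smul_smul, ← sub_smul]
  congr 1
  field_simp
  push_cast
  ring

lemma continuous_partialD {V : Type*} [NormedAddCommGroup V] [NormedSpace ℝ V] {F : R4 → V}
    (hF : ContDiff ℝ 1 F) (k : Fin 4) : Continuous (partialD k F) :=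
  (hF.continuous_fderiv one_ne_zero).clm_apply continuous_const

lemma hasCompactSupport_partialD {V : Type*} [NormedAddCommGroup V] [NormedSpace ℝ V] {F : R4 → V}
    (hF : HasCompactSupport F) (k : Fin 4) : HasCompactSupport (partialD k F) :=
  hF.fderiv_apply (𝕜 := ℝ) _

lemma contDiff_regKernel (θ : ℝ) {ε : ℝ} (hε : 0 < ε) : ContDiff ℝ 1 (regKernel θ ε) := by
  have h4 : ContDiff ℝ 1 (fun x => star (toQuat θ x)) := (conjQuat θ).contDiff
  have hp : ContDiff ℝ 1 fun w : R4 => 2 * Real.pi ^ 2 * (‖w‖ ^ 2 + ε) ^ 2 :=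
    contDiff_const.mul (((contDiff_norm_sq ℝ).add contDiff_const).pow 2)
  refine ContDiff.smul (hp.inv fun w => ?_) h4
  positivity

lemma integral_partialD_smul_regKernel (θ : ℝ) {ε : ℝ} (hε : 0 < ε) {χ : R4 → ℝ}
    (hχ : ContDiff ℝ 1 χ) (hc : HasCompactSupport χ) :
    ∫ w, ∑ k, partialD k χ w • (psi θ k * regKernel θ ε w) =
      -∫ w, χ w • ((4 * ε / (2 * Real.pi ^ 2 * (‖w‖ ^ 2 + ε) ^ 3) : ℝ) : ℍ[ℝ]) := by
  have hK : ∀ k, ContDiff ℝ 1 (fun x => psi θ k * regKernel θ ε x) := fun k =>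
    contDiff_const.mul (contDiff_regKernel θ hε)
  have i1 : ∀ k, Integrable (fun w => partialD k χ w • (psi θ k * regKernel θ ε w)) := fun k =>
    ((continuous_partialD hχ k).smul (hK k).continuous).integrable_of_hasCompactSupport
      (hasCompactSupport_partialD hc k).smul_right
  have i2 : ∀ k, Integrable (fun w => χ w • partialD k (fun x => psi θ k * regKernel θ ε x) w) :=
    fun k => (hχ.continuous.smul (continuous_partialD (hK k) k)).integrable_of_hasCompactSupport
      hc.smul_right
  have i3 : ∀ k, Integrable (fun w => χ w • (psi θ k * regKernel θ ε w)) := fun k =>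
    (hχ.continuous.smul (hK k).continuous).integrable_of_hasCompactSupport hc.smul_right
  rw [integral_finsetSum _ fun k _ => i1 k]
  simp_rw [← sum_partialD_psi_mul_regKernel θ hε, Finset.smul_sum]
  rw [integral_finsetSum _ fun k _ => i2 k, ← Finset.sum_neg_distrib]
  refine Finset.sum_congr rfl fun k _ => ?_
  rw [eq_comm, neg_eq_iff_eq_neg]
  exact integral_smul_fderiv_eq_neg_fderiv_smul_of_integrable (i1 k) (i2 k) (i3 k)
    (fun x _ => hχ.differentiable one_ne_zero x) (fun x _ => (hK k).differentiable one_ne_zero x)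

lemma integral_pow_three_div_Ioi :
    ∫ y in Set.Ioi (0 : ℝ), y ^ 3 * ((1 + y ^ 2) ^ 3)⁻¹ = 1 / 4 := by
  -- The primitive is `(y²/(1+y²))²/4`, written so that its limit at infinity is visible.
  have hd : ∀ y ∈ Set.Ici (0 : ℝ), HasDerivAt (fun y : ℝ => (1 / 4) * (1 - (1 + y ^ 2)⁻¹) ^ 2)
      (y ^ 3 * ((1 + y ^ 2) ^ 3)⁻¹) y := by
    intro y _
    have h1 : HasDerivAt (fun y : ℝ => 1 + y ^ 2) (2 * y) y := by
      simpa using (hasDerivAt_pow 2 y).const_add 1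
    have h2 := (((h1.inv (by positivity)).const_sub 1).pow 2).const_mul (1 / 4 : ℝ)
    refine h2.congr_deriv ?_
    have : (1 + y ^ 2) ≠ 0 := by positivity
    have e : 1 - (1 + y ^ 2)⁻¹ = y ^ 2 / (1 + y ^ 2) := by
      field_simp
      ring
    simp only [Pi.inv_apply, e, Nat.add_one_sub_one, pow_one]
    field_simp
    ring
  have ht : Tendsto (fun y : ℝ => (1 / 4) * (1 - (1 + y ^ 2)⁻¹) ^ 2) atTop (𝓝 (1 / 4)) := by
    have h1 : Tendsto (fun y : ℝ => (1 + y ^ 2)⁻¹) atTop (𝓝 0) :=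
      tendsto_inv_atTop_zero.comp
        (tendsto_atTop_add_const_left _ 1 (tendsto_pow_atTop two_ne_zero))
    simpa using ((h1.const_sub 1).pow 2).const_mul (1 / 4 : ℝ)
  rw [integral_Ioi_of_hasDerivAt_of_nonneg' hd (fun y hy => ?_) ht]
  · simp
  · have : (0 : ℝ) < y := hy
    positivity

/-- In polar coordinates this is `4 · vol(B) · 1/4`, the volume of the unit ball. -/
lemma integral_inv_one_add_norm_sq_pow_three :
    ∫ v : R4, ((1 + ‖v‖ ^ 2) ^ 3)⁻¹ = Real.pi ^ 2 / 2 := by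
  rw [integral_fun_norm_addHaar volume (fun y : ℝ => ((1 + y ^ 2) ^ 3)⁻¹)]
  simp only [finrank_euclideanSpace, Fintype.card_fin, smul_eq_mul, Nat.add_one_sub_one]
  rw [integral_pow_three_div_Ioi, Measure.real, EuclideanSpace.volume_ball]
  have hG : Real.Gamma ((4 : ℕ) / 2 + 1) = 2 := by
    rw [show ((4 : ℕ) : ℝ) / 2 + 1 = ((2 : ℕ) : ℝ) + 1 by norm_num, Real.Gamma_nat_eq_factorial]
    norm_num
  have hs : √Real.pi ^ 4 = Real.pi ^ 2 := by
    rw [show 4 = 2 * 2 by norm_num, pow_mul, Real.sq_sqrt Real.pi_pos.le]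
  simp only [Fintype.card_fin, hG, hs, ENNReal.ofReal_one, one_pow, one_mul]
  rw [ENNReal.toReal_ofReal (by positivity)]
  simp
  ring

/-- The weight is `c⁴ Φ(c w)` with `c = ε^{-1/2}` and `Φ(v) = (2/π²)(1+|v|²)⁻³`, a profile of total
mass 1. -/
lemma tendsto_integral_smul_peak {V : Type*} [NormedAddCommGroup V] [NormedSpace ℝ V]
    [CompleteSpace V] {g : R4 → V} (hg : Integrable g) (hg0 : ContinuousAt g 0) :
    Tendsto (fun ε : ℝ => ∫ w, (4 * ε / (2 * Real.pi ^ 2 * (‖w‖ ^ 2 + ε) ^ 3)) • g w)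
      (𝓝[>] 0) (𝓝 (g 0)) := by
  have hlim : Tendsto (fun x : R4 => ‖x‖ ^ Module.finrank ℝ R4 *
      (2 / Real.pi ^ 2 * ((1 + ‖x‖ ^ 2) ^ 3)⁻¹)) (Bornology.cobounded R4) (𝓝 0) := by
    have h1 : Tendsto (fun y : ℝ => (1 + y ^ 2)⁻¹) atTop (𝓝 0) :=
      tendsto_inv_atTop_zero.comp
        (tendsto_atTop_add_const_left _ 1 (tendsto_pow_atTop two_ne_zero))
    have h2 : Tendsto (fun y : ℝ => 2 / Real.pi ^ 2 * ((1 - (1 + y ^ 2)⁻¹) ^ 2 * (1 + y ^ 2)⁻¹))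
        atTop (𝓝 0) := by
      simpa using (((h1.const_sub 1).pow 2).mul h1).const_mul (2 / Real.pi ^ 2)
    refine (h2.comp tendsto_norm_cobounded_atTop).congr fun x => ?_
    have : (1 + ‖x‖ ^ 2) ≠ 0 := by positivity
    simp only [Function.comp, finrank_euclideanSpace, Fintype.card_fin]
    field_simp
    ring
  have key := tendsto_integral_comp_smul_smul_of_integrable (μ := (volume : Measure R4))
    (φ := fun v => 2 / Real.pi ^ 2 * ((1 + ‖v‖ ^ 2) ^ 3)⁻¹) (fun x => by positivity)
    (by rw [integral_const_mul, integral_inv_one_add_norm_sq_pow_three]; field_simp) hlim hg hg0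
  have hε : Tendsto (fun ε : ℝ => √(ε⁻¹)) (𝓝[>] 0) atTop :=
    Real.tendsto_sqrt_atTop.comp tendsto_inv_nhdsGT_zero
  refine (key.comp hε).congr' ?_
  filter_upwards [self_mem_nhdsWithin] with ε (hpos : 0 < ε)
  refine integral_congr_ae (Eventually.of_forall fun w => ?_)
  simp only [finrank_euclideanSpace, Fintype.card_fin, norm_smul, mul_pow, Real.norm_eq_abs,
    sq_abs, Real.sq_sqrt (inv_pos.2 hpos).le]
  congr 1
  have h4 : √ε⁻¹ ^ 4 = ε⁻¹ ^ 2 := by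
    rw [show 4 = 2 * 2 by norm_num, pow_mul, Real.sq_sqrt (inv_pos.2 hpos).le]
  rw [h4]
  have : 0 < ‖w‖ ^ 2 + ε := by positivity
  have : 1 + ε⁻¹ * ‖w‖ ^ 2 = (‖w‖ ^ 2 + ε) / ε := by field_simp; ring
  rw [this]
  field_simp
  norm_num

lemma integrable_partialD_smul_psi_mul_cauchyKernel (θ : ℝ) {χ : R4 → ℝ}
    (hχ : ContDiff ℝ 1 χ) (hc : HasCompactSupport χ) (k : Fin 4) :
    Integrable (fun w => partialD k χ w • (psi θ k * cauchyKernel θ w)) := by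
  have := ((locallyIntegrable_cauchyKernel θ).integrable_smul_left_of_hasCompactSupport
    (continuous_partialD hχ k) (hasCompactSupport_partialD hc k)).const_mul (psi θ k)
  simpa only [mul_smul_comm] using this

lemma tendsto_integral_partialD_smul_regKernel (θ : ℝ) {χ : R4 → ℝ}
    (hχ : ContDiff ℝ 1 χ) (hc : HasCompactSupport χ) :
    Tendsto (fun ε => ∫ w, ∑ k, partialD k χ w • (psi θ k * regKernel θ ε w)) (𝓝[>] 0)
      (𝓝 (∫ w, ∑ k, partialD k χ w • (psi θ k * cauchyKernel θ w))) := by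
  refine tendsto_integral_filter_of_dominated_convergence
    (fun w => ∑ k, ‖partialD k χ w • (psi θ k * cauchyKernel θ w)‖) ?_ ?_ ?_ ?_
  · filter_upwards [self_mem_nhdsWithin] with ε (hpos : 0 < ε)
    refine Continuous.aestronglyMeasurable (continuous_finsetSum _ fun k _ => ?_)
    exact (continuous_partialD hχ k).smul
      (continuous_const.mul (contDiff_regKernel θ hpos).continuous)
  · filter_upwards [self_mem_nhdsWithin] with ε (hpos : 0 < ε)
    filter_upwards with w
    refine (norm_sum_le _ _).trans (Finset.sum_le_sum fun k _ => ?_)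
    simp only [norm_smul, norm_mul]
    gcongr
    exact norm_regKernel_le θ hpos.le w
  · exact integrable_finsetSum _ fun k _ =>
      (integrable_partialD_smul_psi_mul_cauchyKernel θ hχ hc k).norm
  · filter_upwards with w
    exact tendsto_finsetSum _ fun k _ => ((tendsto_regKernel θ w).const_mul _).const_smul _

/-- The regularised integrals have two limits: one by domination, the other by parts and
concentration at 0. -/
theorem integral_partialD_smul_cauchyKernel (θ : ℝ) {χ : R4 → ℝ}
    (hχ : ContDiff ℝ 1 χ) (hc : HasCompactSupport χ) :
    ∫ w, ∑ k, partialD k χ w • (psi θ k * cauchyKernel θ w) = -((χ 0 : ℝ) : ℍ[ℝ]) := by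
  refine tendsto_nhds_unique (tendsto_integral_partialD_smul_regKernel θ hχ hc) ?_
  have hcoe : Continuous fun w => ((χ w : ℝ) : ℍ[ℝ]) := continuous_coe.comp hχ.continuous
  have hint : Integrable fun w => ((χ w : ℝ) : ℍ[ℝ]) :=
    hcoe.integrable_of_hasCompactSupport (hc.comp_left (g := fun r : ℝ => (r : ℍ[ℝ])) (by simp))
  refine (tendsto_integral_smul_peak hint hcoe.continuousAt).neg.congr' ?_
  filter_upwards [self_mem_nhdsWithin] with ε (hpos : 0 < ε)
  rw [integral_partialD_smul_regKernel θ hpos hχ hc]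
  congr 1
  refine integral_congr_ae (Eventually.of_forall fun w => ?_)
  simp only [smul_coe, mul_comm]

/-! ### The weighted kernel -/

/-- `pairing θ u` as a continuous linear functional. -/
noncomputable def pairingCLM (θ : ℝ) (u : ℍ[ℝ]) : R4 →L[ℝ] ℝ :=
  ∑ k, coord θ u k • EuclideanSpace.proj k

lemma pairingCLM_apply (θ : ℝ) (u : ℍ[ℝ]) (x : R4) : pairingCLM θ u x = pairing θ u x := by
  simp [pairingCLM, pairing]

lemma pairingCLM_single (θ : ℝ) (u : ℍ[ℝ]) (k : Fin 4) :
    pairingCLM θ u (EuclideanSpace.single k 1) = coord θ u k := by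
  simp [pairingCLM]

lemma continuous_pairing (θ : ℝ) (u : ℍ[ℝ]) : Continuous (pairing θ u) :=
  (pairingCLM θ u).continuous.congr (pairingCLM_apply θ u)

lemma locallyIntegrable_kernelU (θ : ℝ) (u : ℍ[ℝ]) : LocallyIntegrable (kernelU θ u) := by
  exact (locallyIntegrable_cauchyKernel θ).continuous_smul
    (Real.continuous_exp.comp (continuous_pairing θ u))

lemma neg_kernelU_neg (θ : ℝ) (u : ℍ[ℝ]) (w : R4) :
    -kernelU θ u (-w) = Real.exp (-pairingCLM θ u w) • cauchyKernel θ w := by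
  rw [kernelU, cauchyKernel_neg, ← pairingCLM_apply, map_neg, smul_neg, neg_neg]

/-- The quaternion `-∑ ∂φ/∂xₖ ψₖ + φ u`, by which the formal adjoint of `crOp` acts on the scalar
function `φ`. -/
noncomputable def adjointSymbol (θ : ℝ) (u : ℍ[ℝ]) (φ : R4 → ℝ) (x : R4) : ℍ[ℝ] :=
  -(∑ k, partialD k φ x • psi θ k) + φ x • u

lemma adjointSymbol_mul (θ : ℝ) (u : ℍ[ℝ]) (φ : R4 → ℝ) (x : R4) (q : ℍ[ℝ]) :
    adjointSymbol θ u φ x * q =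
      -(∑ k, partialD k φ x • (psi θ k * q)) + φ x • (u * q) := by
  simp [adjointSymbol, add_mul, Finset.sum_mul]

lemma continuous_adjointSymbol (θ : ℝ) (u : ℍ[ℝ]) {φ : R4 → ℝ} (hφ : ContDiff ℝ 1 φ) :
    Continuous (adjointSymbol θ u φ) :=
  (continuous_finsetSum _ fun k _ => (continuous_partialD hφ k).smul continuous_const).neg.add
    (hφ.continuous.smul continuous_const)

lemma partialD_eq_zero {V : Type*} [NormedAddCommGroup V] [NormedSpace ℝ V] {φ : R4 → V} {x : R4}
    (hx : x ∉ tsupport φ) (k : Fin 4) : partialD k φ x = 0 := by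
  rw [partialD, fderiv_of_notMem_tsupport (𝕜 := ℝ) hx]
  rfl

lemma adjointSymbol_eq_zero (θ : ℝ) (u : ℍ[ℝ]) {φ : R4 → ℝ} {x : R4} (hx : x ∉ tsupport φ) :
    adjointSymbol θ u φ x = 0 := by
  simp [adjointSymbol, partialD_eq_zero hx, image_eq_zero_of_notMem_tsupport hx]

lemma hasCompactSupport_adjointSymbol (θ : ℝ) (u : ℍ[ℝ]) {φ : R4 → ℝ} (hc : HasCompactSupport φ) :
    HasCompactSupport (adjointSymbol θ u φ) :=
  HasCompactSupport.intro hc fun _ hx => adjointSymbol_eq_zero θ u hx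

lemma partialD_exp_mul (θ : ℝ) (u : ℍ[ℝ]) {φ : R4 → ℝ} (hφ : ContDiff ℝ 1 φ) (ζ w : R4)
    (k : Fin 4) :
    partialD k (fun w => Real.exp (-pairingCLM θ u w) * φ (ζ + w)) w =
      Real.exp (-pairingCLM θ u w) * (partialD k φ (ζ + w) - φ (ζ + w) * coord θ u k) := by
  have h1 : HasFDerivAt (fun w => φ (ζ + w)) (fderiv ℝ φ (ζ + w)) w := by
    have := (hφ.differentiable one_ne_zero (ζ + w)).hasFDerivAt
    exact (hasFDerivAt_comp_add_left ζ).2 this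
  have h2 := ((pairingCLM θ u).hasFDerivAt (x := w)).neg.exp.mul h1
  have h3 : HasFDerivAt (fun w => Real.exp (-pairingCLM θ u w) * φ (ζ + w)) _ w := h2
  rw [partialD, h3.fderiv]
  simp [pairingCLM_single, partialD]
  ring

theorem integral_adjointSymbol_mul_kernelU (θ : ℝ) (u : ℍ[ℝ]) {φ : R4 → ℝ}
    (hφ : ContDiff ℝ 1 φ) (hc : HasCompactSupport φ) (ζ : R4) :
    ∫ z, adjointSymbol θ u φ z * (-kernelU θ u (ζ - z)) = ((φ ζ : ℝ) : ℍ[ℝ]) := by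
  set χ : R4 → ℝ := fun w => Real.exp (-pairingCLM θ u w) * φ (ζ + w) with hχdef
  have hχ : ContDiff ℝ 1 χ :=
    ((pairingCLM θ u).contDiff.neg.exp).mul (hφ.comp (contDiff_const.add contDiff_id))
  have hχc : HasCompactSupport χ :=
    (hc.comp_homeomorph (Homeomorph.addLeft ζ)).mul_left
  have key := integral_partialD_smul_cauchyKernel θ hχ hχc
  have h0 : χ 0 = φ ζ := by simp [hχdef]
  rw [h0] at key
  rw [← integral_add_left_eq_self _ ζ, ← neg_neg ((φ ζ : ℝ) : ℍ[ℝ]), ← key, ← integral_neg]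
  refine integral_congr_ae (Eventually.of_forall fun w => ?_)
  have hu := sum_coord_smul_psi θ u
  simp only [sub_add_cancel_left, neg_kernelU_neg, hχdef, partialD_exp_mul θ u hφ]
  conv_lhs => rw [adjointSymbol, ← hu]
  simp only [mul_sub, sub_smul, Finset.sum_sub_distrib, neg_sub, mul_smul_comm, add_mul, neg_mul,
    Finset.sum_mul, Finset.smul_sum, smul_mul_assoc, smul_add, smul_neg, smul_smul]
  rw [neg_add_eq_sub]
  -- Expanding `u` in the basis also hit the `u` inside the exponential; this restores it.
  rw [hu]

/-! ### The Teodorescu operator as a weak right inverse -/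

/-- No integrability is needed, as left multiplication by `q ≠ 0` is invertible. Hence it applies
even at points where the Teodorescu integral diverges. -/
lemma integral_quaternion_const_mul {α : Type*} [MeasurableSpace α] {μ : Measure α} (q : ℍ[ℝ])
    (g : α → ℍ[ℝ]) : ∫ x, q * g x ∂μ = q * ∫ x, g x ∂μ :=
  integral_smul q g

lemma integral_quaternion_mul_const {α : Type*} [MeasurableSpace α] {μ : Measure α} {g : α → ℍ[ℝ]}
    (hg : Integrable g μ) (q : ℍ[ℝ]) : ∫ x, g x * q ∂μ = (∫ x, g x ∂μ) * q :=
  ((ContinuousLinearMap.mul ℝ ℍ[ℝ]).flip q).integral_comp_comm hg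

lemma integrable_prod_kernelU_mul (θ : ℝ) (u : ℍ[ℝ]) {Ω : Set R4} (hΩ : MeasurableSet Ω)
    (hb : Bornology.IsBounded Ω) {f : R4 → ℍ[ℝ]} (hf : IntegrableOn f Ω) :
    Integrable (fun p : R4 × R4 => kernelU θ u (p.2 - p.1) * f p.2)
      ((volume.restrict Ω).prod (volume.restrict Ω)) := by
  obtain ⟨R, hR⟩ := hb.subset_ball 0
  -- Differences of points of `Ω` have norm at most `2R`, so truncating the kernel there makes it
  -- integrable and changes nothing on `Ω × Ω`.
  have hk : Integrable ((Metric.closedBall (0 : R4) (2 * R)).indicator (kernelU θ u)) :=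
    ((locallyIntegrable_kernelU θ u).integrableOn_isCompact
      (isCompact_closedBall 0 (2 * R))).integrable_indicator measurableSet_closedBall
  have h := (hf.integrable_indicator hΩ).convolution_integrand (ContinuousLinearMap.mul ℝ ℍ[ℝ]).flip
    hk.comp_neg
  rw [Measure.prod_restrict]
  refine IntegrableOn.congr_fun h.integrableOn ?_ (hΩ.prod hΩ)
  rintro ⟨z, ζ⟩ ⟨hz, hζ⟩
  have h1 := hR hz
  have h2 := hR hζ
  have hm : ζ - z ∈ Metric.closedBall (0 : R4) (2 * R) := by
    rw [mem_closedBall_zero_iff]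
    rw [mem_ball_zero_iff] at h1 h2
    linarith [norm_sub_le ζ z]
  have hζ' : ζ ∈ Ω := hζ
  simp [Set.indicator_of_mem hζ', Set.indicator_of_mem hm]

lemma ae_integrableOn_kernelU_mul (θ : ℝ) (u : ℍ[ℝ]) {Ω : Set R4} (hΩ : MeasurableSet Ω)
    (hb : Bornology.IsBounded Ω) {f : R4 → ℍ[ℝ]} (hf : IntegrableOn f Ω) :
    ∀ᵐ z ∂(volume.restrict Ω), IntegrableOn (fun ζ => kernelU θ u (ζ - z) * f ζ) Ω :=
  (integrable_prod_kernelU_mul θ u hΩ hb hf).prod_right_ae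

lemma integrableOn_teodorescu (θ : ℝ) (u : ℍ[ℝ]) {Ω : Set R4} (hΩ : MeasurableSet Ω)
    (hb : Bornology.IsBounded Ω) {f : R4 → ℍ[ℝ]} (hf : IntegrableOn f Ω) :
    IntegrableOn (teodorescu θ u Ω f) Ω :=
  (integrable_prod_kernelU_mul θ u hΩ hb hf).integral_prod_left.neg

lemma locallyIntegrable_comp_homeomorph {X V : Type*} [TopologicalSpace X]
    [LocallyCompactSpace X] [MeasurableSpace X] [BorelSpace X] {μ : Measure X}
    [NormedAddCommGroup V] {g : X → V} (hg : LocallyIntegrable g μ) (e : X ≃ₜ X)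
    (he : MeasurePreserving e μ μ) : LocallyIntegrable (fun x => g (e x)) μ := by
  rw [locallyIntegrable_iff]
  intro K hK
  exact (he.integrableOn_image e.measurableEmbedding).1
    (hg.integrableOn_isCompact (hK.image e.continuous))

lemma continuousOn_kernelU (θ : ℝ) (u : ℍ[ℝ]) : ContinuousOn (kernelU θ u) {0}ᶜ := by
  have h : cauchyKernel θ = fun w => (1 / (2 * Real.pi ^ 2 * ‖w‖ ^ 4)) • star (toQuat θ w) :=
    funext (cauchyKernel_eq θ)
  refine (Real.continuous_exp.comp (continuous_pairing θ u)).continuousOn.smul ?_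
  rw [h]
  have hp : Continuous fun w : R4 => 2 * Real.pi ^ 2 * ‖w‖ ^ 4 := by fun_prop
  refine ContinuousOn.smul (continuousOn_const.div hp.continuousOn fun w hw => ?_)
    (continuous_toQuat θ).star.continuousOn
  have : 0 < ‖w‖ := norm_pos_iff.2 hw
  positivity

/-- Near `z`, `f` is bounded and the kernel integrable; away from `z`, the kernel is bounded and `f`
integrable. -/
lemma integrableOn_kernelU_mul_of_continuousOn (θ : ℝ) (u : ℍ[ℝ]) {Ω : Set R4} (hΩ : IsOpen Ω)
    (hb : Bornology.IsBounded Ω) {f : R4 → ℍ[ℝ]} (hf : IntegrableOn f Ω) (hc : ContinuousOn f Ω)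
    {z : R4} (hz : z ∈ Ω) : IntegrableOn (fun ζ => kernelU θ u (ζ - z) * f ζ) Ω := by
  obtain ⟨r, hr, hrΩ⟩ := Metric.nhds_basis_closedBall.mem_iff.1 (hΩ.mem_nhds hz)
  have hB := isCompact_closedBall z r
  have h1 : IntegrableOn (fun ζ => kernelU θ u (ζ - z) * f ζ) (Metric.closedBall z r) :=
    ((locallyIntegrable_comp_homeomorph (locallyIntegrable_kernelU θ u)
      (Homeomorph.subRight z) (measurePreserving_sub_right volume z)).integrableOn_isCompact
      hB).mul_continuousOn (hc.mono hrΩ) hB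
  have hK : IsCompact (closure Ω \ Metric.ball z r) := hb.isCompact_closure.diff Metric.isOpen_ball
  have hcont : ContinuousOn (fun ζ => kernelU θ u (ζ - z)) (closure Ω \ Metric.ball z r) := by
    refine (continuousOn_kernelU θ u).comp (by fun_prop) fun ζ hζ h0 => hζ.2 ?_
    rw [sub_eq_zero.1 h0]
    exact Metric.mem_ball_self hr
  have h2 : IntegrableOn (fun ζ => kernelU θ u (ζ - z) * f ζ) (Ω \ Metric.ball z r) :=
    (hf.mono_set Set.sdiff_subset).continuousOn_mul_of_subset hcont hK
      (hΩ.measurableSet.diff measurableSet_ball) (Set.sdiff_subset_sdiff_left subset_closure)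
  refine (h1.union h2).mono_set fun x hx => ?_
  by_cases h : x ∈ Metric.ball z r
  · exact Or.inl (Metric.ball_subset_closedBall h)
  · exact Or.inr ⟨hx, h⟩

lemma integral_adjointSymbol_mul_teodorescu (θ : ℝ) (u : ℍ[ℝ]) {Ω : Set R4}
    (hΩ : MeasurableSet Ω) (hb : Bornology.IsBounded Ω) {f : R4 → ℍ[ℝ]} (hf : IntegrableOn f Ω)
    {φ : R4 → ℝ} (hφ : ContDiff ℝ 1 φ) (hc : HasCompactSupport φ) (hs : tsupport φ ⊆ Ω) :
    ∫ x in Ω, adjointSymbol θ u φ x * teodorescu θ u Ω f x = ∫ x in Ω, φ x • f x := by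
  have hM := continuous_adjointSymbol θ u hφ
  have hMc := hasCompactSupport_adjointSymbol θ u hc
  obtain ⟨C, hC⟩ := hM.bounded_above_of_compact_support hMc
  have hint : Integrable (Function.uncurry fun x ζ =>
      adjointSymbol θ u φ x * -(kernelU θ u (ζ - x) * f ζ))
      ((volume.restrict Ω).prod (volume.restrict Ω)) :=
    (integrable_prod_kernelU_mul θ u hΩ hb hf).neg.bdd_mul
      (hM.comp continuous_fst).aestronglyMeasurable (Eventually.of_forall fun p => hC p.1)
  calc ∫ x in Ω, adjointSymbol θ u φ x * teodorescu θ u Ω f x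
      = ∫ x in Ω, ∫ ζ in Ω, adjointSymbol θ u φ x * -(kernelU θ u (ζ - x) * f ζ) := by
        simp only [integral_quaternion_const_mul, integral_neg, teodorescu]
    _ = ∫ ζ in Ω, ∫ x in Ω, adjointSymbol θ u φ x * -(kernelU θ u (ζ - x) * f ζ) :=
        integral_integral_swap hint
    _ = ∫ ζ in Ω, φ ζ • f ζ := by
        refine integral_congr_ae (Eventually.of_forall fun ζ => ?_)
        simp only [← neg_mul, ← mul_assoc]
        -- The symbol vanishes off `Ω`, so the inner integral extends to the whole space, where the
        -- fundamental solution identity applies.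
        rw [setIntegral_eq_integral_of_forall_compl_eq_zero, integral_quaternion_mul_const,
          integral_adjointSymbol_mul_kernelU θ u hφ hc, coe_mul_eq_smul]
        · have hl := (locallyIntegrable_comp_homeomorph (locallyIntegrable_kernelU θ u)
            (Homeomorph.subLeft ζ) (Measure.measurePreserving_sub_left volume ζ)).neg
          exact hl.integrable_smul_left_of_hasCompactSupport hM hMc
        · intro x hx
          rw [adjointSymbol_eq_zero θ u fun h => hx (hs h), zero_mul, zero_mul]

theorem weakCR_teodorescu (θ : ℝ) (u : ℍ[ℝ]) {Ω : Set R4}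
    (hΩ : MeasurableSet Ω) (hb : Bornology.IsBounded Ω) {f : R4 → ℍ[ℝ]} (hf : IntegrableOn f Ω) :
    WeakCR θ u Ω (teodorescu θ u Ω f) f := by
  refine ⟨(integrableOn_teodorescu θ u hΩ hb hf).locallyIntegrableOn, hf.locallyIntegrableOn,
    fun φ hφ hc hs => ?_⟩
  simp only [← adjointSymbol_mul]
  exact integral_adjointSymbol_mul_teodorescu θ u hΩ hb hf (hφ.of_le (by simp)) hc hs

/-! ### Classical solutions -/

section Classical

variable {V : Type*} [NormedAddCommGroup V] [NormedSpace ℝ V] {Ω : Set R4}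

/-- `F` may be arbitrary outside `Ω`; the product is still continuous, being zero near every point
off its support. -/
lemma integrable_smul_of_tsupport_subset (hΩ : IsOpen Ω) {g : R4 → ℝ} (hg : Continuous g)
    (hc : HasCompactSupport g) (hs : tsupport g ⊆ Ω) {F : R4 → V} (hF : ContinuousOn F Ω) :
    Integrable (fun x => g x • F x) := by
  refine Continuous.integrable_of_hasCompactSupport (continuous_of_tsupport fun x hx => ?_)
    hc.smul_right
  exact hg.continuousAt.smul
    (hF.continuousAt (hΩ.mem_nhds (hs (tsupport_smul_subset_left g F hx))))

lemma tsupport_partialD_subset (φ : R4 → V) (k : Fin 4) : tsupport (partialD k φ) ⊆ tsupport φ :=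
  closure_minimal (fun _ hx => not_not.1 fun h => hx (partialD_eq_zero h k)) (isClosed_tsupport φ)

lemma continuousOn_partialD (hΩ : IsOpen Ω) {F : R4 → V} (hF : ContDiffOn ℝ 1 F Ω) (k : Fin 4) :
    ContinuousOn (partialD k F) Ω :=
  (hF.continuousOn_fderiv_of_isOpen hΩ le_rfl).clm_apply continuousOn_const

lemma integral_smul_partialD (hΩ : IsOpen Ω) {φ : R4 → ℝ} (hφ : ContDiff ℝ 1 φ)
    (hc : HasCompactSupport φ) (hs : tsupport φ ⊆ Ω) {F : R4 → V} (hF : ContDiffOn ℝ 1 F Ω)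
    (k : Fin 4) : ∫ x, φ x • partialD k F x = -∫ x, partialD k φ x • F x := by
  have hd : ∀ x ∈ tsupport φ, DifferentiableAt ℝ F x := fun x hx =>
    ((hF x (hs hx)).contDiffAt (hΩ.mem_nhds (hs hx))).differentiableAt one_ne_zero
  exact integral_smul_fderiv_eq_neg_fderiv_smul_of_integrable
    (integrable_smul_of_tsupport_subset hΩ (continuous_partialD hφ k)
      (hasCompactSupport_partialD hc k) ((tsupport_partialD_subset φ k).trans hs) hF.continuousOn)
    (integrable_smul_of_tsupport_subset hΩ hφ.continuous hc hs (continuousOn_partialD hΩ hF k))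
    (integrable_smul_of_tsupport_subset hΩ hφ.continuous hc hs hF.continuousOn)
    (fun x _ => hφ.differentiable one_ne_zero x) hd

end Classical

lemma continuousOn_crOp (θ : ℝ) (u : ℍ[ℝ]) {Ω : Set R4} (hΩ : IsOpen Ω) {F : R4 → ℍ[ℝ]}
    (hF : ContDiffOn ℝ 1 F Ω) : ContinuousOn (crOp θ u F) Ω :=
  (continuousOn_finsetSum _ fun k _ =>
    continuousOn_const.mul (continuousOn_partialD hΩ hF k)).add
    (continuousOn_const.mul hF.continuousOn)

/-- Integration by parts in each coordinate; the real-valued `φ` commutes with `ψₖ` and `u`. -/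
lemma integral_smul_crOp (θ : ℝ) (u : ℍ[ℝ]) {Ω : Set R4} (hΩ : IsOpen Ω) {φ : R4 → ℝ}
    (hφ : ContDiff ℝ 1 φ) (hc : HasCompactSupport φ) (hs : tsupport φ ⊆ Ω) {F : R4 → ℍ[ℝ]}
    (hF : ContDiffOn ℝ 1 F Ω) :
    ∫ x, φ x • crOp θ u F x = ∫ x, adjointSymbol θ u φ x * F x := by
  have i1 : ∀ k, Integrable fun x => psi θ k * (φ x • partialD k F x) := fun k =>
    (integrable_smul_of_tsupport_subset hΩ hφ.continuous hc hs
      (continuousOn_partialD hΩ hF k)).const_mul _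
  have i2 : ∀ k, Integrable fun x => -(psi θ k * (partialD k φ x • F x)) := fun k =>
    (integrable_smul_of_tsupport_subset hΩ (continuous_partialD hφ k)
      (hasCompactSupport_partialD hc k) ((tsupport_partialD_subset φ k).trans hs)
      hF.continuousOn).const_mul _ |>.neg
  have i3 : Integrable fun x => u * (φ x • F x) :=
    (integrable_smul_of_tsupport_subset hΩ hφ.continuous hc hs hF.continuousOn).const_mul _
  simp only [adjointSymbol_mul, crOp, smul_add, Finset.smul_sum, ← mul_smul_comm,
    ← Finset.sum_neg_distrib]
  rw [integral_add (integrable_finsetSum _ fun k _ => i1 k) i3,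
    integral_add (integrable_finsetSum _ fun k _ => i2 k) i3,
    integral_finsetSum _ fun k _ => i1 k, integral_finsetSum _ fun k _ => i2 k]
  simp only [integral_neg, integral_quaternion_const_mul,
    integral_smul_partialD hΩ hφ hc hs hF, mul_neg]

theorem crOp_ae_eq_of_weakCR (θ : ℝ) (u : ℍ[ℝ]) {Ω : Set R4} (hΩ : IsOpen Ω)
    {F G g : R4 → ℍ[ℝ]} (hF : ContDiffOn ℝ 1 F Ω) (hFG : F =ᵐ[volume.restrict Ω] G)
    (hG : WeakCR θ u Ω G g) : crOp θ u F =ᵐ[volume.restrict Ω] g := by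
  obtain ⟨-, hg, hw⟩ := hG
  have hcr : LocallyIntegrableOn (crOp θ u F) Ω :=
    (continuousOn_crOp θ u hΩ hF).locallyIntegrableOn hΩ.measurableSet
  have key := hΩ.ae_eq_zero_of_integral_contDiff_smul_eq_zero (hcr.sub hg) fun φ hφ hc hs => ?_
  · rw [EventuallyEq, ae_restrict_iff' hΩ.measurableSet]
    filter_upwards [key] with x hx hxΩ
    exact sub_eq_zero.1 (hx hxΩ)
  · have hφ1 : ContDiff ℝ 1 φ := hφ.of_le (by simp)
    have e1 : ∫ x, φ x • crOp θ u F x = ∫ x, φ x • g x := by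
      have h0 : ∀ x ∉ Ω, φ x = 0 := fun x hx =>
        image_eq_zero_of_notMem_tsupport fun h => hx (hs h)
      rw [integral_smul_crOp θ u hΩ hφ1 hc hs hF,
        ← setIntegral_eq_integral_of_forall_compl_eq_zero (s := Ω) fun x hx => by
          rw [adjointSymbol_eq_zero θ u fun h => hx (hs h), zero_mul],
        ← setIntegral_eq_integral_of_forall_compl_eq_zero (s := Ω) (f := fun x => φ x • g x)
          fun x hx => by rw [h0 x hx, zero_smul], ← hw φ hφ hc hs]
      refine integral_congr_ae ?_
      filter_upwards [hFG] with x hx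
      rw [adjointSymbol_mul, hx]
    have i1 : Integrable fun x => φ x • crOp θ u F x :=
      integrable_smul_of_tsupport_subset hΩ hφ.continuous hc hs (continuousOn_crOp θ u hΩ hF)
    have i2 : Integrable fun x => φ x • g x := by
      have h := (hg.integrableOn_compact_subset hs hc).continuousOn_smul hφ.continuous.continuousOn
        hc
      refine (integrableOn_iff_integrable_of_support_subset fun x hx => ?_).1 h
      exact subset_tsupport φ (Function.support_smul_subset_left φ g hx)
    simp only [Pi.sub_apply, smul_sub]
    rw [integral_sub i1 i2, e1, sub_self]

end ThetaHyper

theorem proposition3p4 (θ : ℝ) (u : Quaternion ℝ) (Ω : Set ThetaHyper.R4)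
    (hΩ : IsOpen Ω) (hb : Bornology.IsBounded Ω) (f : ThetaHyper.R4 → Quaternion ℝ)
    (hf : MemLp f 2 (volume.restrict Ω) ∨ (ContinuousOn f Ω ∧ IntegrableOn f Ω)) :
    -- the integral defining `T^θ_u[f](z)` converges absolutely
    (∀ᵐ z ∂(volume.restrict Ω), IntegrableOn (fun ζ => ThetaHyper.kernelU θ u (ζ - z) * f ζ) Ω) ∧
    (ContinuousOn f Ω →
      ∀ z ∈ Ω, IntegrableOn (fun ζ => ThetaHyper.kernelU θ u (ζ - z) * f ζ) Ω) ∧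
    -- `D^θ_u[T^θ_u[f]] = f` on `Ω` in the sense of distributions
    ThetaHyper.WeakCR θ u Ω (ThetaHyper.teodorescu θ u Ω f) f ∧
    -- and classically, for a `C¹` representative of `T^θ_u[f]` if there is one
    (∀ F : ThetaHyper.R4 → Quaternion ℝ, ContDiffOn ℝ 1 F Ω →
      F =ᵐ[volume.restrict Ω] ThetaHyper.teodorescu θ u Ω f →
        ThetaHyper.crOp θ u F =ᵐ[volume.restrict Ω] f ∧
        (ContinuousOn f Ω → ∀ z ∈ Ω, ThetaHyper.crOp θ u F z = f z)) := by
  have hfi : IntegrableOn f Ω := by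
    rcases hf with h | h
    -- On a bounded set `L²` embeds in `L¹`.
    · have : IsFiniteMeasure (volume.restrict Ω) :=
        isFiniteMeasure_restrict.2 hb.measure_lt_top.ne
      exact h.integrable one_le_two
    · exact h.2
  have hw := ThetaHyper.weakCR_teodorescu θ u hΩ.measurableSet hb hfi
  refine ⟨ThetaHyper.ae_integrableOn_kernelU_mul θ u hΩ.measurableSet hb hfi, fun hc z hz =>
    ThetaHyper.integrableOn_kernelU_mul_of_continuousOn θ u hΩ hb hfi hc hz, hw,
    fun F hF hFT => ?_⟩
  have h := ThetaHyper.crOp_ae_eq_of_weakCR θ u hΩ hF hFT hw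
  exact ⟨h, fun hc z hz =>
    Measure.eqOn_open_of_ae_eq h hΩ (ThetaHyper.continuousOn_crOp θ u hΩ hF) hc hz⟩
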